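/- **Setting (CFL).** Fix a dimension $d\ge 1$, constants $0<L<U$, and weight vectors $\mathbf w\in\mathbb R^d_{\ge 0}$, $\mathbf c\in\mathbb R^d_{>0}$. For a weight vector $\mathbf v$ write $\|\mathbf x\|_{\ell_1(\mathbf v)}=\sum_i \mathbf v^i|\mathbf x^i|$, and put $c(\mathbf x)=\|\mathbf x\|_{\ell_1(\mathbf c)}$, $X=\{\mathbf x\in\mathbb R^d: c(\mathbf x)\le 1\}$, $\beta=\max_i \mathbf w^i/\mathbf c^i$, and assume $\beta\in[0,\frac{U-L}{2})$. An input consists of a horizon $T$ and convex differentiable hitting costs $f_1,\dots,f_T:X\to\mathbb R$ with $f_t(\mathbf 0)=0$ and $L\le[\nabla f_t(\mathbf x)]^i/\mathbf c^i\le U$ for all $i$ and all $\mathbf x\in X$. A sequence $\mathbf x_1,\dots,\mathbf x_T\in X\cap[0,1]^d$ is feasible if $\sum_{t=1}^T c(\mathbf x_t)\ge 1$; with $\mathbf x_0=\mathbf x_{T+1}=\mathbf 0$ its cost is $\sum_{t=1}^T f_t(\mathbf x_t)+\sum_{t=1}^{T+1}\|\mathbf x_t-\mathbf x_{t-1}\|_{\ell_1(\mathbf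 w)}$. Fix $T_0\in\mathbb N$ and let $\Omega$ be the set of inputs with $T\ge T_0$ that admit a feasible sequence; $\mathrm{OPT}(\mathcal I)$ is the least cost of a feasible sequence for $\mathcal I\in\Omega$. Advice for $\mathcal I$ is a feasible sequence $\mathrm{ADV}=(\mathbf a_1,\dots,\mathbf a_T)$, with cost $\mathrm{ADV}(\mathcal I)$. A (deterministic) learning-augmented algorithm for CFL chooses $\mathbf x_t$ online, as a function of $T$, $f_1,\dots,f_t$ and $\mathbf a_1,\dots,\mathbf a_t$, and produces a feasible sequence for every $\mathcal I\in\Omega$ and every advice. It is $b$-consistent if its cost is at most $b\cdot\mathrm{ADV}(\mathcal I)$, and $r$-robust if its cost is at most $r\cdot\mathrm{OPT}(\mathcal I)$, in both cases for every $\mathcal I\in\Omega$ and every advice. **Theorem.** There is exactly one $\alpha>0$ with $$\frac{U-L-2\beta}{U-U/\alpha-2\beta}=e^{1/\alpha}.$$ For every $\epsilon\in(0,\alpha-1]$ there is exactly one $\gamma^\epsilon\in[\alpha,U/L]$ with $$\gamma^\epsilon=\epsilon+\frac UL-\frac{\gamma^\epsilon}{L}(U-L)\ln\!\left(\frac{U-L-2\beta}{U-U/\gamma^\epsilon-2\beta}\right).$$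 Every $(1+\epsilon)$-consistent learning-augmented algorithm for CFL is at least $\gamma^\epsilon$-robust: if it is $r$-robust, then $r\ge\gamma^\epsilon$. Moreover, the trade-off $(1+\epsilon,\gamma^\epsilon)$ cannot be improved in consistency either: if a learning-augmented algorithm for CFL is $b$-consistent with $b<1+\epsilon$ and $r$-robust, then $r>\gamma^\epsilon$. Thus any algorithm that is $(1+\epsilon)$-consistent and $\gamma^\epsilon$-robust attains the optimal consistency–robustness trade-off. -/

import Mathlib

/-- The parameters of convex function chasing with a long-term constraint (CFL) in dimension `d`:
the weight vector `w` of the switching cost, the weight vector `c` of the long-term constraint, and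
the gradient bounds `L` and `U`.  The normalized switching magnitude `max_i w i / c i` (a maximum
over a finite non-empty index set) lies in `[0, (U - L) / 2)`. -/
structure CFL (d : ℕ) where
  w : Fin d → ℝ
  c : Fin d → ℝ
  L : ℝ
  U : ℝ
  w_nonneg : ∀ i, 0 ≤ w i
  c_pos : ∀ i, 0 < c i
  L_pos : 0 < L
  beta_lt : (⨆ i, w i / c i) < (U - L) / 2

namespace CFL

variable {d : ℕ}

/-- The weighted `ℓ₁` norm with weight vector `v`. -/
def wnorm (v x : Fin d → ℝ) : ℝ := ∑ i, v i * |x i|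

/-- `β = max_i w i / c i`. -/
noncomputable def beta (P : CFL d) : ℝ := ⨆ i, P.w i / P.c i

/-- The metric space `X`: the unit ball of the norm `c(x) = ‖x‖_{ℓ₁(c)}`. -/
def X (P : CFL d) : Set (Fin d → ℝ) := {x | wnorm P.c x ≤ 1}

/-- Admissible hitting costs: convex and differentiable on `X`, zero at the origin, with
`L ≤ [∇ f]ᵢ / cᵢ ≤ U` for every coordinate `i` throughout `X`.  (`X` is a convex body, so the
derivative within `X` is unique.) -/
structure IsCost (P : CFL d) (f : (Fin d → ℝ) → ℝ) : Prop where
  convex : ConvexOn ℝ P.X f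
  zero : f 0 = 0
  grad : ∀ x ∈ P.X, ∃ f' : (Fin d → ℝ) →L[ℝ] ℝ, HasFDerivWithinAt f f' P.X x ∧
    ∀ i, P.L ≤ f' (Pi.single i 1) / P.c i ∧ f' (Pi.single i 1) / P.c i ≤ P.U

/-- Decision sequences `x 1, …, x T` that are feasible for horizon `T`: points of `X` with
coordinates in `[0, 1]` that satisfy the long-term constraint.  Values of `x` at times
outside `1, …, T` play no role. -/
def Feasible (P : CFL d) (T : ℕ) (x : ℕ → Fin d → ℝ) : Prop :=
  (∀ t ∈ Finset.Icc 1 T, x t ∈ P.X ∧ ∀ i, x t i ∈ Set.Icc (0 : ℝ) 1) ∧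
    1 ≤ ∑ t ∈ Finset.Icc 1 T, wnorm P.c (x t)

/-- The trajectory of the decisions `x 1, …, x T`, which starts and ends at the origin:
its values at times `0` and `T + 1` are `0`. -/
def path (T : ℕ) (x : ℕ → Fin d → ℝ) (t : ℕ) : Fin d → ℝ :=
  if t ∈ Finset.Icc 1 T then x t else 0

/-- Total cost: hitting costs at times `1, …, T` plus switching costs at times `1, …, T + 1`. -/
noncomputable def cost (P : CFL d) (T : ℕ) (f : ℕ → (Fin d → ℝ) → ℝ) (x : ℕ → Fin d → ℝ) : ℝ :=
  ∑ t ∈ Finset.Icc 1 T, f t (x t) +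
    ∑ t ∈ Finset.Icc 1 (T + 1), wnorm P.w (path T x t - path T x (t - 1))

/-- The valid inputs of horizon at least `T₀`: a horizon `T` and admissible hitting costs
`f 1, …, f T`, such that some feasible decision sequence exists. -/
def IsInstance (P : CFL d) (T₀ T : ℕ) (f : ℕ → (Fin d → ℝ) → ℝ) : Prop :=
  T₀ ≤ T ∧ (∀ t ∈ Finset.Icc 1 T, P.IsCost (f t)) ∧ ∃ x, P.Feasible T x

/-- The optimal offline cost. -/
noncomputable def opt (P : CFL d) (T : ℕ) (f : ℕ → (Fin d → ℝ) → ℝ) : ℝ :=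
  sInf {v | ∃ x, P.Feasible T x ∧ v = P.cost T f x}

/-- A deterministic learning-augmented online algorithm in dimension `d`: given the horizon `T`,
the hitting costs `f` and the advice `a`, it plays `act T f a t` at time `t`, and this decision
depends only on `T` and on the hitting costs and the advice revealed at times `1, …, t`. -/
structure Alg (d : ℕ) where
  act : ℕ → (ℕ → (Fin d → ℝ) → ℝ) → (ℕ → Fin d → ℝ) → ℕ → Fin d → ℝ
  causal : ∀ (T : ℕ) (f f' : ℕ → (Fin d → ℝ) → ℝ) (a a' : ℕ → Fin d → ℝ), ∀ t ∈ Finset.Icc 1 T,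
    (∀ s ∈ Finset.Icc 1 t, f s = f' s ∧ a s = a' s) → act T f a t = act T f' a' t

/-- `A` is an algorithm for CFL (on inputs of horizon at least `T₀`): its decisions are feasible on
every valid input with every feasible advice. -/
def Solves (P : CFL d) (T₀ : ℕ) (A : Alg d) : Prop :=
  ∀ T f, P.IsInstance T₀ T f → ∀ a, P.Feasible T a → P.Feasible T (A.act T f a)

/-- `b`-consistency: `A` is `b`-competitive with respect to the advice. -/
def Consistent (P : CFL d) (T₀ : ℕ) (A : Alg d) (b : ℝ) : Prop :=
  ∀ T f, P.IsInstance T₀ T f → ∀ a, P.Feasible T a →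
    P.cost T f (A.act T f a) ≤ b * P.cost T f a

/-- `r`-robustness: `A` is `r`-competitive with respect to the offline optimum, whatever the
advice. -/
def Robust (P : CFL d) (T₀ : ℕ) (A : Alg d) (r : ℝ) : Prop :=
  ∀ T f, P.IsInstance T₀ T f → ∀ a, P.Feasible T a →
    P.cost T f (A.act T f a) ≤ r * P.opt T f

/-- `α` is the positive solution of `(U - L - 2β) / (U - U/α - 2β) = exp (1/α)`. -/
def IsAlpha (P : CFL d) (α : ℝ) : Prop :=
  0 < α ∧
    (P.U - P.L - 2 * P.beta) / (P.U - P.U / α - 2 * P.beta) = Real.exp (1 / α)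

/-- `γ` is the target robustness factor for `ε`: the solution in `[α, U/L]` of
`γ = ε + U/L - (γ/L) (U - L) log ((U - L - 2β) / (U - U/γ - 2β))`. -/
def IsGamma (P : CFL d) (α ε γ : ℝ) : Prop :=
  γ ∈ Set.Icc α (P.U / P.L) ∧
    γ = ε + P.U / P.L - γ / P.L * (P.U - P.L) *
      Real.log ((P.U - P.L - 2 * P.beta) / (P.U - P.U / γ - 2 * P.beta))

end CFL

/-! Choose the coordinate `k` with `w k / c k = β` and linear hitting costs whose price is `p` per
unit of `c` in coordinate `k` and `U` in all others. Relative to buying everything at `U`, an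
algorithm pays at least `U` times the amount bought minus its saving. Because the trajectory starts
and ends at `0`, switching charges at least `2β` for every unit by which the amount bought per step
decreases.

An adversary lowers `p` from `U/r` to `L`. Once `p` has been offered for `m` steps, spreading the
purchase over them costs at most `p + 2β/m`, so `r`-robustness forces a saving of about `U - r p`.
The player must not save at the full rate `U - p`: whenever most of what it bought at `p` comes in a
single step, the price returns to `U` for a while, and stopping then costs `2β` per unit. Any
noticeable purchase within `m` steps contains such a step (`exists_dominant_step`), and robustness
bounds total purchases, so interruptions end after boundedly many attempts (`exists_offer`). Hence
saving accrues at rate essentially at most `U - 2β - p`, and integrating the forced saving over `p`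
shows that about `r log ((U - L - 2β) / (U - U/r - 2β))` is bought by the time `L` is reached
(`exists_history`).

The advice has been zero so far, and now buys everything at price `L`. Consistency `b` bounds `(U -
L) * bought - saving`, and in the limit of fine price levels this becomes `surplus r ≤ b - 1`
(`tradeoff`). The function `surplus` is convex along the relevant range, equals `α - 1` at `α` and
`0` at `U/L`. It therefore takes the value `ε` exactly once, at `γ`, and is larger than `ε` to the
left of `γ`, which excludes smaller robustness; at `γ` itself it excludes `b < 1 + ε`. -/

namespace CFL

/-! ### The price game

A price history is a list of prices whose head is the most recent price, and `u h` is the amount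
that a player buys at the last time of the history `h`. -/

/-- Total amount bought along a price history. -/
noncomputable def bought (u : List ℝ → ℝ) : List ℝ → ℝ
  | [] => 0
  | p :: h => bought u h + u (p :: h)

/-- Saving along a price history, compared to buying at price `U`, net of the penalty `s` per
unit of decrease of the amount bought per step. -/
noncomputable def saving (u : List ℝ → ℝ) (U s : ℝ) : List ℝ → ℝ
  | [] => 0
  | p :: h => saving u U s h + (U - p) * u (p :: h) - s * max 0 (u h - u (p :: h))

variable {u : List ℝ → ℝ} {U s : ℝ}

lemma bought_nonneg (hu : ∀ h, 0 ≤ u h) (h : List ℝ) : 0 ≤ bought u h := by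
  induction h with
  | nil => simp [bought]
  | cons p h ih => exact add_nonneg ih (hu _)

lemma bought_le_append (hu : ∀ h, 0 ≤ u h) (l h : List ℝ) : bought u h ≤ bought u (l ++ h) := by
  induction l with
  | nil => simp
  | cons p l ih => exact ih.trans (le_add_of_nonneg_right (hu _))

lemma saving_replicate_le (hs : 0 ≤ s) (p : ℝ) (m : ℕ) (h : List ℝ) :
    saving u U s (List.replicate m p ++ h) - saving u U s h ≤
      (U - p) * (bought u (List.replicate m p ++ h) - bought u h) := by
  induction m with
  | zero => simp
  | succ m ih =>
    simp only [List.replicate_succ, List.cons_append, saving, bought]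
    have := mul_nonneg hs (le_max_left 0 (u (List.replicate m p ++ h) -
      u (p :: (List.replicate m p ++ h))))
    linarith

/-- Nothing is saved at price `U`, and the penalties, bounded below by signed decreases, telescope.
-/
lemma saving_replicate_top_le (hs : 0 ≤ s) (N : ℕ) (h : List ℝ) :
    saving u U s (List.replicate N U ++ h) ≤
      saving u U s h - s * (u h - u (List.replicate N U ++ h)) := by
  induction N with
  | zero => simp
  | succ N ih =>
    simp only [List.replicate_succ, List.cons_append, saving]
    have := mul_le_mul_of_nonneg_left (le_max_right 0 (u (List.replicate N U ++ h) -
      u (U :: (List.replicate N U ++ h)))) hs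
    linarith

/-- Averaging over the `N` steps: a player that keeps its rate up to avoid the penalty must buy at
price `U` throughout, so each unit bought there wins back only `s / N`. -/
lemma mul_saving_replicate_top_le (hs : 0 ≤ s) (N : ℕ) (h : List ℝ) :
    N * saving u U s (List.replicate N U ++ h) ≤ N * (saving u U s h - s * u h) +
      s * (bought u (List.replicate N U ++ h) - bought u h) := by
  induction N with
  | zero => simp
  | succ N ih =>
    have h1 := saving_replicate_top_le (u := u) (U := U) hs (N + 1) h
    have h2 : saving u U s (List.replicate (N + 1) U ++ h) ≤
        saving u U s (List.replicate N U ++ h) := by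
      simp only [List.replicate_succ, List.cons_append, saving]
      have := mul_nonneg hs (le_max_left 0 (u (List.replicate N U ++ h) -
        u (U :: (List.replicate N U ++ h))))
      linarith
    have h3 : bought u (List.replicate (N + 1) U ++ h) =
        bought u (List.replicate N U ++ h) + u (List.replicate (N + 1) U ++ h) := by
      simp only [List.replicate_succ, List.cons_append, bought]
    have h4 := mul_le_mul_of_nonneg_left h2 (Nat.cast_nonneg (α := ℝ) N)
    rw [h3]
    push_cast
    linarith

/-- If a player buys at least `κ` during `m` steps at a constant price, then there is a step at
which most of what was bought so far is bought at once. -/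
lemma exists_dominant_step {ρ : ℝ} (hρ : 0 < ρ) (p : ℝ) (h : List ℝ) (m : ℕ) :
    ∀ κ : ℝ, 0 < κ → κ ≤ bought u (List.replicate m p ++ h) - bought u h →
      ∃ k ≤ m, κ * (ρ / (1 + ρ)) ^ m ≤ bought u (List.replicate k p ++ h) - bought u h ∧
        bought u (List.replicate k p ++ h) - bought u h ≤
          (1 + ρ) * u (List.replicate k p ++ h) := by
  have hθ : 0 < ρ / (1 + ρ) := by positivity
  have hθ1 : ρ / (1 + ρ) ≤ 1 := by rw [div_le_one (by positivity)]; linarith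
  induction m with
  | zero => intro κ hκ h1; simp at h1; linarith
  | succ m ih =>
    intro κ hκ h1
    by_cases hc : bought u (List.replicate (m + 1) p ++ h) - bought u h ≤
        (1 + ρ) * u (List.replicate (m + 1) p ++ h)
    · exact ⟨m + 1, le_rfl, (mul_le_of_le_one_right hκ.le (pow_le_one₀ hθ.le hθ1)).trans h1, hc⟩
    · have h3 : bought u (List.replicate (m + 1) p ++ h) =
          bought u (List.replicate m p ++ h) + u (List.replicate (m + 1) p ++ h) := by
        simp only [List.replicate_succ, List.cons_append, bought]
      push Not at hc
      rw [h3] at hc h1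
      -- A last step that is not dominant contributes less than `1 / (1 + ρ)` of the total, so the
      -- fraction `ρ / (1 + ρ)` was bought before it.
      have h4 : κ * (ρ / (1 + ρ)) ≤ bought u (List.replicate m p ++ h) - bought u h := by
        rw [← mul_div_assoc, div_le_iff₀ (by positivity)]
        nlinarith
      obtain ⟨k, hk, h5, h6⟩ := ih _ (by positivity) h4
      exact ⟨k, by omega, by rw [pow_succ']; linarith, h6⟩

/-- One attempt to offer the price `p` during `m` steps. -/
lemma offer_or_interrupt (hu : ∀ h, 0 ≤ u h) (hs : 0 ≤ s) {ρ κ p : ℝ} (hρ : 0 < ρ) (hκ : 0 < κ)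
    {N : ℕ} (hN : 0 < N) (hNp : s / N ≤ U - s - p) (m : ℕ) (h : List ℝ) :
    saving u U s (List.replicate m p ++ h) - saving u U s h ≤
        (U - s - p + s * ρ) * (bought u (List.replicate m p ++ h) - bought u h) + s * κ ∨
    ∃ l : List ℝ, l.length ≤ m + N ∧ (∀ q ∈ l, q = p ∨ q = U) ∧
      κ * (ρ / (1 + ρ)) ^ m ≤ bought u (l ++ h) - bought u h ∧
      saving u U s (l ++ h) - saving u U s h ≤
        (U - s - p + s * ρ) * (bought u (l ++ h) - bought u h) := by
  by_cases hc : κ ≤ bought u (List.replicate m p ++ h) - bought u h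
  · right
    obtain ⟨k, hk, h1, h2⟩ := exists_dominant_step hρ p h m κ hκ hc
    -- The price jumps to `U` immediately after the dominant step, when the player's rate `u` is
    -- highest relative to what it has bought.
    refine ⟨List.replicate N U ++ List.replicate k p, ?_, ?_, ?_, ?_⟩
    · simp; omega
    · intro q hq
      simp only [List.mem_append, List.mem_replicate] at hq
      tauto
    · rw [List.append_assoc]
      have := bought_le_append hu (List.replicate N U) (List.replicate k p ++ h)
      linarith
    · rw [List.append_assoc]
      have h3 := saving_replicate_le (u := u) (U := U) hs p k h
      have h4 := mul_saving_replicate_top_le (u := u) (U := U) hs N (List.replicate k p ++ h)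
      have h5 := bought_le_append hu (List.replicate N U) (List.replicate k p ++ h)
      have h6 := bought_le_append hu (List.replicate k p) h
      have hN' : (0 : ℝ) < N := by exact_mod_cast hN
      generalize saving u U s (List.replicate N U ++ (List.replicate k p ++ h)) = x1 at *
      generalize bought u (List.replicate N U ++ (List.replicate k p ++ h)) = y1 at *
      generalize saving u U s (List.replicate k p ++ h) = x2 at *
      generalize bought u (List.replicate k p ++ h) = y2 at *
      generalize u (List.replicate k p ++ h) = v at *
      have h7 : x1 ≤ x2 - s * v + s / N * (y1 - y2) := by
        have : N * x1 ≤ N * (x2 - s * v + s / N * (y1 - y2)) := by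
          have e : N * (s / N * (y1 - y2)) = s * (y1 - y2) := by field_simp
          linarith
        exact le_of_mul_le_mul_left this hN'
      -- What is bought at `U` to soften the drop wins back no more per unit than buying at
      -- effective price `p + s`.
      have h8 : s / N * (y1 - y2) ≤ (U - s - p) * (y1 - y2) :=
        mul_le_mul_of_nonneg_right hNp (by linarith)
      have h9 : (1 - ρ) * (y2 - bought u h) ≤ v := by
        have h10 : (1 - ρ) * (y2 - bought u h) * (1 + ρ) ≤ v * (1 + ρ) := by
          nlinarith [mul_nonneg (sq_nonneg ρ) (sub_nonneg.2 h6)]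
        exact le_of_mul_le_mul_right h10 (by linarith)
      have h10 := mul_le_mul_of_nonneg_left h9 hs
      have h11 : 0 ≤ s * ρ * (y1 - y2) := mul_nonneg (by positivity) (by linarith)
      linarith
  · left
    push Not at hc
    have h3 := saving_replicate_le (u := u) (U := U) hs p m h
    have h6 := bought_le_append hu (List.replicate m p) h
    have h7 := mul_le_mul_of_nonneg_left hc.le hs
    have h8 : 0 ≤ s * ρ * (bought u (List.replicate m p ++ h) - bought u h) :=
      mul_nonneg (by positivity) (by linarith)
    linarith

/-- After boundedly many interrupted attempts the price `p` can be offered during `m` steps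
such that any saving of the player is paid by an amount bought at effective price `p + s`. -/
lemma exists_offer_or_bought (hu : ∀ h, 0 ≤ u h) (hs : 0 ≤ s) {ρ κ p : ℝ} (hρ : 0 < ρ)
    (hκ : 0 < κ) {N : ℕ} (hN : 0 < N) (hNp : s / N ≤ U - s - p) (m : ℕ) (h : List ℝ) (j : ℕ) :
    (∃ l : List ℝ, l.length ≤ j * (m + N) ∧ (∀ q ∈ l, q = p ∨ q = U) ∧
      saving u U s (List.replicate m p ++ (l ++ h)) - saving u U s h ≤
        (U - s - p + s * ρ) * (bought u (List.replicate m p ++ (l ++ h)) - bought u h) + s * κ) ∨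
    ∃ l : List ℝ, l.length ≤ j * (m + N) ∧ (∀ q ∈ l, q = p ∨ q = U) ∧
      j * (κ * (ρ / (1 + ρ)) ^ m) ≤ bought u (l ++ h) - bought u h ∧
      saving u U s (l ++ h) - saving u U s h ≤
        (U - s - p + s * ρ) * (bought u (l ++ h) - bought u h) := by
  induction j with
  | zero => exact Or.inr ⟨[], by simp⟩
  | succ j ih =>
    rcases ih with ⟨l, h1, h2, h3⟩ | ⟨l, h1, h2, h3, h4⟩
    · exact Or.inl ⟨l, h1.trans (Nat.mul_le_mul_right _ j.le_succ), h2, h3⟩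
    · rcases offer_or_interrupt hu hs hρ hκ hN hNp m (l ++ h) with h5 | ⟨l', h5, h6, h7, h8⟩
      · exact Or.inl ⟨l, h1.trans (Nat.mul_le_mul_right _ j.le_succ), h2, by linarith⟩
      · refine Or.inr ⟨l' ++ l, ?_, ?_, ?_, ?_⟩
        · rw [List.length_append, Nat.succ_mul]; omega
        · intro q hq
          rcases List.mem_append.1 hq with hq | hq
          · exact h6 q hq
          · exact h2 q hq
        · rw [List.append_assoc]; push_cast; linarith
        · rw [List.append_assoc]; linarith

/-- Each interruption yields a purchase of at least `κ * (ρ / (1 + ρ)) ^ m`, so the cap `Q` rules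
out `j` of them. -/
lemma exists_offer (hu : ∀ h, 0 ≤ u h) (hs : 0 ≤ s) {ρ κ p Q : ℝ} (hρ : 0 < ρ)
    (hκ : 0 < κ) {N : ℕ} (hN : 0 < N) (hNp : s / N ≤ U - s - p) (m : ℕ) (h : List ℝ) (j : ℕ)
    (hj : Q < j * (κ * (ρ / (1 + ρ)) ^ m))
    (hQ : ∀ l : List ℝ, l.length ≤ j * (m + N) → (∀ q ∈ l, q = p ∨ q = U) →
      bought u (l ++ h) ≤ Q) :
    ∃ l : List ℝ, l.length ≤ j * (m + N) ∧ (∀ q ∈ l, q = p ∨ q = U) ∧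
      saving u U s (List.replicate m p ++ (l ++ h)) - saving u U s h ≤
        (U - s - p + s * ρ) * (bought u (List.replicate m p ++ (l ++ h)) - bought u h) +
          s * κ := by
  rcases exists_offer_or_bought hu hs hρ hκ hN hNp m h j with h1 | ⟨l, h1, h2, h3, h4⟩
  · exact h1
  · have := hQ l h1 h2
    have := bought_nonneg hu h
    linarith

/-- One step of comparing a Riemann sum with the integral of the reciprocal; the quadratic error
disappears when the levels are refined. -/
lemma log_div_sub_le {x y z δ : ℝ} (hz : 0 < z) (hzx : z ≤ x) (hδ : 0 ≤ δ) (hy : y = x + δ) :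
    Real.log (y / x) - δ ^ 2 / z ^ 2 ≤ δ / y := by
  have hx : 0 < x := hz.trans_le hzx
  have hy0 : 0 < y := by linarith
  have h1 : Real.log (y / x) ≤ y / x - 1 := Real.log_le_sub_one_of_pos (by positivity)
  have h2 : y / x - 1 - δ / y = δ ^ 2 / (x * y) := by
    subst hy; field_simp; ring
  have h3 : δ ^ 2 / (x * y) ≤ δ ^ 2 / z ^ 2 := by
    apply div_le_div_of_nonneg_left (by positivity) (by positivity)
    nlinarith
  linarith

/-- The descending price adversary. -/
theorem exists_history (hu : ∀ h, 0 ≤ u h) (hs : 0 ≤ s) {L ρ κ p₀ δ r η Q : ℝ} (hρ : 0 < ρ)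
    (hκ : 0 < κ) {N : ℕ} (hN : 0 < N) (hNp : s / N ≤ U - s - p₀) (hp₀ : 0 < U - s - p₀)
    (hr : 0 ≤ r) (hη : 0 ≤ η) (hδ : 0 ≤ δ) (hLU : L ≤ U) (hp₀U : p₀ ≤ U) (m n j : ℕ)
    (hn : L ≤ p₀ - n * δ) (hj : Q < j * (κ * (ρ / (1 + ρ)) ^ m))
    (hQ : ∀ h : List ℝ, h.length ≤ (n + 1) * (j * (m + N) + m) → (∀ q ∈ h, L ≤ q ∧ q ≤ U) →
      bought u h ≤ Q)
    (hsav : ∀ p h, (List.replicate m p ++ h).length ≤ (n + 1) * (j * (m + N) + m) →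
      L ≤ p → p ≤ U → (∀ q ∈ h, L ≤ q ∧ q ≤ U) →
      r * (p₀ - p) - η ≤ saving u U s (List.replicate m p ++ h)) :
    ∀ i ≤ n, ∃ h : List ℝ, h.length ≤ (i + 1) * (j * (m + N) + m) ∧
      (∀ q ∈ h, L ≤ q ∧ q ≤ U) ∧ r * (i * δ) - η ≤ saving u U s h ∧
      (saving u U s h - (r * (i * δ) - η)) / (U - s - p₀ + i * δ + s * ρ) +
        r * Real.log ((U - s - p₀ + i * δ + s * ρ) / (U - s - p₀ + s * ρ)) -
        i * (r * (δ ^ 2 / (U - s - p₀) ^ 2) + s * κ / (U - s - p₀)) -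
        (s * κ + η) / (U - s - p₀) ≤ bought u h := by
  have hsρ : 0 ≤ s * ρ := by positivity
  have hsκ : 0 ≤ s * κ := by positivity
  have step : ∀ i ≤ n, ∀ h : List ℝ, h.length ≤ i * (j * (m + N) + m) →
      (∀ q ∈ h, L ≤ q ∧ q ≤ U) → ∃ h' : List ℝ, h'.length ≤ (i + 1) * (j * (m + N) + m) ∧
      (∀ q ∈ h', L ≤ q ∧ q ≤ U) ∧ r * (i * δ) - η ≤ saving u U s h' ∧
      saving u U s h' - saving u U s h ≤
        (U - s - p₀ + i * δ + s * ρ) * (bought u h' - bought u h) + s * κ := by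
    intro i hi h hh hhm
    have hin : (i : ℝ) * δ ≤ n * δ := mul_le_mul_of_nonneg_right (by exact_mod_cast hi) hδ
    have hi0 : 0 ≤ (i : ℝ) * δ := by positivity
    have hmem : ∀ l : List ℝ, (∀ q ∈ l, q = p₀ - i * δ ∨ q = U) →
        ∀ q ∈ l ++ h, L ≤ q ∧ q ≤ U := by
      intro l hl q hq
      rcases List.mem_append.1 hq with hq | hq
      · rcases hl q hq with rfl | rfl <;> constructor <;> linarith
      · exact hhm q hq
    have hlen : (i + 1) * (j * (m + N) + m) ≤ (n + 1) * (j * (m + N) + m) :=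
      Nat.mul_le_mul_right _ (by omega)
    have hlen' : (i + 1) * (j * (m + N) + m) = i * (j * (m + N) + m) + j * (m + N) + m := by ring
    obtain ⟨l, h1, h2, h3⟩ := exists_offer (p := p₀ - i * δ) hu hs hρ hκ hN (by linarith) m h j hj
      (fun l h1 h2 => hQ _ (by rw [List.length_append]; omega) (hmem l h2))
    have h4 : (List.replicate m (p₀ - i * δ) ++ (l ++ h)).length ≤
        (i + 1) * (j * (m + N) + m) := by
      simp only [List.length_append, List.length_replicate]; omega
    refine ⟨_, h4, ?_, ?_, ?_⟩
    · intro q hq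
      rcases List.mem_append.1 hq with hq | hq
      · rw [List.eq_of_mem_replicate hq]; constructor <;> linarith
      · exact hmem l h2 q hq
    · have := hsav (p₀ - i * δ) (l ++ h) (h4.trans hlen) (by linarith) (by linarith) (hmem l h2)
      convert this using 2; ring
    · convert h3 using 3; ring
  intro i
  induction i with
  | zero =>
    intro _
    obtain ⟨h, h1, h2, h3, h4⟩ := step 0 (by omega) [] (by simp) (by simp)
    refine ⟨h, h1, h2, h3, ?_⟩
    have hpos : 0 < U - s - p₀ + s * ρ := by linarith
    simp only [saving, bought, Nat.cast_zero, zero_mul, add_zero, mul_zero, zero_sub, sub_zero]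
      at h4 ⊢
    rw [div_self hpos.ne', Real.log_one]
    have h5 : (saving u U s h - -η) / (U - s - p₀ + s * ρ) ≤
        bought u h + (s * κ + η) / (U - s - p₀ + s * ρ) := by
      rw [div_le_iff₀ hpos, add_mul, div_mul_cancel₀ _ hpos.ne']
      linarith
    have h6 : (s * κ + η) / (U - s - p₀ + s * ρ) ≤ (s * κ + η) / (U - s - p₀) :=
      div_le_div_of_nonneg_left (by linarith) hp₀ (by linarith)
    linarith
  | succ i ih =>
    intro hi
    obtain ⟨h, h1, h2, h3, h4⟩ := ih (by omega)
    obtain ⟨h', h1', h2', h3', h4'⟩ := step (i + 1) hi h h1 h2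
    refine ⟨h', h1', h2', h3', ?_⟩
    have hi0 : 0 ≤ (i : ℝ) * δ := by positivity
    have hlog := log_div_sub_le (x := U - s - p₀ + i * δ + s * ρ)
      (y := U - s - p₀ + (i + 1 : ℕ) * δ + s * ρ) hp₀ (by linarith) hδ (by push_cast; ring)
    have hposx : 0 < U - s - p₀ + i * δ + s * ρ := by linarith
    have hxy : U - s - p₀ + (i + 1 : ℕ) * δ + s * ρ = U - s - p₀ + i * δ + s * ρ + δ := by
      push_cast; ring
    have hR : r * ((i + 1 : ℕ) * δ) - η = r * (i * δ) - η + r * δ := by push_cast; ring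
    have hposz : 0 < U - s - p₀ + s * ρ := by linarith
    have hxz : U - s - p₀ ≤ U - s - p₀ + i * δ + s * ρ := by linarith
    rw [hxy] at hlog h4' ⊢
    rw [hR]
    generalize r * (i * δ) - η = R at *
    generalize U - s - p₀ + i * δ + s * ρ = x at *
    generalize U - s - p₀ + s * ρ = z at *
    generalize U - s - p₀ = A at *
    generalize saving u U s h = φ at *
    generalize saving u U s h' = φ' at *
    have hyp : 0 < x + δ := by linarith
    have e1 : Real.log ((x + δ) / z) = Real.log ((x + δ) / x) + Real.log (x / z) := by
      rw [← Real.log_mul (by positivity) (by positivity)]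
      congr 1; field_simp
    rw [e1]
    -- Saving made ahead of the forced level `R` has used at least as much purchase as the same
    -- saving would at the next, cheaper level.
    have e2 : (φ - R) / (x + δ) ≤ (φ - R) / x :=
      div_le_div_of_nonneg_left (by linarith) hposx (by linarith)
    have e3 : (φ' - φ) / (x + δ) ≤ bought u h' - bought u h + s * κ / (x + δ) := by
      rw [div_le_iff₀ hyp, add_mul, div_mul_cancel₀ _ hyp.ne']
      linarith
    have e4 : s * κ / (x + δ) ≤ s * κ / A :=
      div_le_div_of_nonneg_left hsκ hp₀ (by linarith)
    have e5 : (φ' - (R + r * δ)) / (x + δ) =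
        (φ - R) / (x + δ) + (φ' - φ) / (x + δ) - r * (δ / (x + δ)) := by
      field_simp; ring
    have e6 := mul_le_mul_of_nonneg_left hlog hr
    rw [e5]
    push_cast
    linarith

end CFL

namespace CFL

/-! ### Inputs given by price histories -/

/-- The price at time `t` when the prices of a history are followed by the price `U` forever. -/
noncomputable def priceAt (U : ℝ) : List ℝ → ℕ → ℝ
  | [], _ => U
  | p :: h, t => if t = h.length + 1 then p else priceAt U h t

lemma priceAt_mem {L U : ℝ} (hLU : L ≤ U) {h : List ℝ} (hh : ∀ q ∈ h, L ≤ q ∧ q ≤ U) (t : ℕ) :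
    L ≤ priceAt U h t ∧ priceAt U h t ≤ U := by
  induction h with
  | nil => exact ⟨hLU, le_rfl⟩
  | cons p h ih =>
    simp only [priceAt]
    split_ifs
    · exact hh p (by simp)
    · exact ih fun q hq => hh q (by simp [hq])

lemma priceAt_suffix {U : ℝ} {l h : List ℝ} (hl : l <:+ h) {t : ℕ} (ht : t ≤ l.length) :
    priceAt U h t = priceAt U l t := by
  induction h with
  | nil => rw [List.suffix_nil.1 hl]
  | cons p h ih =>
    rcases List.suffix_cons_iff.1 hl with rfl | hl
    · rfl
    · have := hl.length_le
      rw [priceAt, if_neg (by omega), ih hl]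

lemma priceAt_of_length_lt {U : ℝ} {h : List ℝ} {t : ℕ} (ht : h.length < t) :
    priceAt U h t = U := by
  induction h with
  | nil => rfl
  | cons p h ih =>
    rw [List.length_cons] at ht
    rw [priceAt, if_neg (by omega), ih (by omega)]

lemma priceAt_replicate {U p : ℝ} {h : List ℝ} {m t : ℕ}
    (ht : t ∈ Finset.Ioc h.length (h.length + m)) :
    priceAt U (List.replicate m p ++ h) t = p := by
  induction m with
  | zero => simp at ht
  | succ m ih =>
    simp only [List.replicate_succ, List.cons_append, priceAt, List.length_append,
      List.length_replicate]
    split_ifs with h1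
    · rfl
    · refine ih ?_
      rw [Finset.mem_Ioc] at ht ⊢
      omega

lemma sum_Icc_eq_sum_range (F : ℕ → ℝ) (n : ℕ) :
    ∑ t ∈ Finset.Icc 1 n, F t = ∑ t ∈ Finset.range n, F (t + 1) := by
  induction n with
  | zero => simp
  | succ n ih => rw [Finset.sum_Icc_succ_top (by omega), Finset.sum_range_succ, ih]

lemma sum_Icc_add_sum_Ioc (F : ℕ → ℝ) {n T : ℕ} (h : n ≤ T) :
    ∑ t ∈ Finset.Icc 1 n, F t + ∑ t ∈ Finset.Ioc n T, F t = ∑ t ∈ Finset.Icc 1 T, F t := by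
  rw [← Finset.sum_union]
  · congr 1; ext t; simp only [Finset.mem_union, Finset.mem_Icc, Finset.mem_Ioc]; omega
  · rw [Finset.disjoint_left]; intro t; simp only [Finset.mem_Icc, Finset.mem_Ioc]; omega

lemma bought_eq_sum {u : List ℝ → ℝ} {g : ℕ → ℝ} {h : List ℝ}
    (hg : ∀ l, l <:+ h → u l = g l.length) :
    bought u h = ∑ t ∈ Finset.Icc 1 h.length, g t := by
  induction h with
  | nil => simp [bought]
  | cons p h ih =>
    rw [bought, ih fun l hl => hg l (hl.trans (List.suffix_cons p h)), hg _ (List.suffix_refl _),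
      List.length_cons, Finset.sum_Icc_succ_top (by omega)]

lemma saving_eq_sum {u : List ℝ → ℝ} {U s : ℝ} {g : ℕ → ℝ} {h : List ℝ}
    (hg : ∀ l, l <:+ h → u l = g l.length) :
    saving u U s h = ∑ t ∈ Finset.Icc 1 h.length,
      ((U - priceAt U h t) * g t - s * max 0 (g (t - 1) - g t)) := by
  induction h with
  | nil => simp [saving]
  | cons p h ih =>
    rw [saving, ih fun l hl => hg l (hl.trans (List.suffix_cons p h)), hg _ (List.suffix_refl _),
      hg _ (List.suffix_cons p h), List.length_cons, Finset.sum_Icc_succ_top (by omega), priceAt,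
      if_pos rfl, Nat.add_sub_cancel, add_sub_assoc]
    congr 1
    refine Finset.sum_congr rfl fun t ht => ?_
    rw [Finset.mem_Icc] at ht
    rw [priceAt, if_neg (by omega)]

lemma saving_le {u : List ℝ → ℝ} {L U s : ℝ} (hu : ∀ h, 0 ≤ u h) (hs : 0 ≤ s) {h : List ℝ}
    (hh : ∀ q ∈ h, L ≤ q ∧ q ≤ U) : saving u U s h ≤ (U - L) * bought u h := by
  induction h with
  | nil => simp [saving, bought]
  | cons p h ih =>
    have h1 := ih fun q hq => hh q (by simp [hq])
    have h2 := mul_nonneg (sub_nonneg.2 (hh p (by simp)).1) (hu (p :: h))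
    have h3 := mul_nonneg hs (le_max_left 0 (u h - u (p :: h)))
    simp only [saving, bought]
    linarith

/-! ### Linear costs in one coordinate, and their switching costs -/

section Cost

variable {d : ℕ} (P : CFL d) (k : Fin d)

/-- The linear hitting cost with price `p` in coordinate `k` and price `U` in all others. -/
noncomputable def priceCost (p : ℝ) (x : Fin d → ℝ) : ℝ :=
  ∑ i, (if i = k then p else P.U) * P.c i * x i

/-- The hitting costs given by a price history. -/
noncomputable def inputOf (h : List ℝ) (t : ℕ) : (Fin d → ℝ) → ℝ :=
  P.priceCost k (priceAt P.U h t)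

/-- The amount that an algorithm without advice buys in coordinate `k` at the last time of a
price history. -/
noncomputable def response (T : ℕ) (A : Alg d) (h : List ℝ) : ℝ :=
  if h = [] then 0 else P.c k * |A.act T (P.inputOf k h) 0 h.length k|

/-- The decisions that buy `1 / m` in coordinate `k` at each of the `m` times after time `s`. -/
noncomputable def spread (s m : ℕ) (t : ℕ) : Fin d → ℝ :=
  if t ∈ Finset.Ioc s (s + m) then Pi.single k (1 / (m * P.c k)) else 0

variable {P k}

lemma response_nonneg (T : ℕ) (A : Alg d) (h : List ℝ) : 0 ≤ P.response k T A h := by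
  unfold response
  split_ifs
  · exact le_rfl
  · exact mul_nonneg (P.c_pos k).le (abs_nonneg _)

lemma beta_nonneg (P : CFL d) : 0 ≤ P.beta :=
  Real.iSup_nonneg fun i => div_nonneg (P.w_nonneg i) (P.c_pos i).le

lemma two_mul_beta_lt (P : CFL d) : 2 * P.beta < P.U - P.L := by
  have := P.beta_lt
  unfold beta
  linarith

lemma L_lt_U (P : CFL d) : P.L < P.U := by
  linarith [P.two_mul_beta_lt, P.beta_nonneg]

lemma isCost_priceCost {p : ℝ} (hp : P.L ≤ p) (hpU : p ≤ P.U) : P.IsCost (P.priceCost k p) := by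
  let F : (Fin d → ℝ) →L[ℝ] ℝ :=
    ∑ i, ((if i = k then p else P.U) * P.c i) • ContinuousLinearMap.proj i
  have hF : ∀ x, F x = P.priceCost k p x := by
    intro x
    simp only [F, priceCost, sum_apply, smul_apply,
      ContinuousLinearMap.proj_apply, smul_eq_mul]
  have hF' : P.priceCost k p = F := funext fun x => (hF x).symm
  have hX : Convex ℝ P.X := by
    intro x hx y hy a b ha hb hab
    simp only [X, wnorm, Set.mem_ofPred_eq] at hx hy ⊢
    have : ∑ i, P.c i * |(a • x + b • y) i| ≤
        ∑ i, (a * (P.c i * |x i|) + b * (P.c i * |y i|)) := by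
      refine Finset.sum_le_sum fun i _ => ?_
      have h1 : |a * x i + b * y i| ≤ a * |x i| + b * |y i| := by
        refine (abs_add_le _ _).trans ?_
        rw [abs_mul, abs_mul, abs_of_nonneg ha, abs_of_nonneg hb]
      have := mul_le_mul_of_nonneg_left h1 (P.c_pos i).le
      simp only [Pi.add_apply, Pi.smul_apply, smul_eq_mul]
      linarith
    rw [Finset.sum_add_distrib, ← Finset.mul_sum, ← Finset.mul_sum] at this
    nlinarith
  refine ⟨?_, ?_, fun x _ => ⟨F, ?_, fun i => ?_⟩⟩
  · rw [hF']
    exact F.toLinearMap.convexOn hX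
  · rw [hF', map_zero]
  · rw [hF']
    exact F.hasFDerivWithinAt
  · have : F (Pi.single i 1) / P.c i = if i = k then p else P.U := by
      rw [hF, priceCost, Finset.sum_eq_single i]
      · have := (P.c_pos i).ne'
        simp only [Pi.single_eq_same]; field_simp
      · intro j _ hj; simp [hj]
      · simp
    rw [this]
    have := P.L_lt_U.le
    split_ifs <;> constructor <;> linarith

lemma priceCost_eq (p : ℝ) {x : Fin d → ℝ} (hx : ∀ i, 0 ≤ x i) :
    P.priceCost k p x = P.U * wnorm P.c x - (P.U - p) * (P.c k * x k) := by
  have h1 : wnorm P.c x = ∑ i, P.c i * x i :=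
    Finset.sum_congr rfl fun i _ => by rw [abs_of_nonneg (hx i)]
  have h2 : (P.U - p) * (P.c k * x k) = ∑ i, if i = k then (P.U - p) * (P.c i * x i) else 0 := by
    simp
  rw [h1, h2, Finset.mul_sum, ← Finset.sum_sub_distrib]
  refine Finset.sum_congr rfl fun i _ => ?_
  split_ifs <;> ring

lemma priceCost_nonneg {p : ℝ} (hp : 0 ≤ p) {x : Fin d → ℝ} (hx : ∀ i, 0 ≤ x i) :
    0 ≤ P.priceCost k p x := by
  refine Finset.sum_nonneg fun i _ => ?_
  have := P.L_lt_U
  have := P.L_pos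
  have := (P.c_pos i).le
  have := hx i
  split_ifs <;> first | positivity | exact mul_nonneg (mul_nonneg (by linarith) ‹_›) ‹_›

lemma priceCost_single (p y : ℝ) : P.priceCost k p (Pi.single k y) = p * P.c k * y := by
  rw [priceCost, Finset.sum_eq_single k]
  · simp
  · intro j _ hj; simp [hj]
  · simp

lemma priceCost_zero (p : ℝ) : P.priceCost k p 0 = 0 := by
  simp [priceCost]

lemma wnorm_nonneg {v : Fin d → ℝ} (hv : ∀ i, 0 ≤ v i) (x : Fin d → ℝ) : 0 ≤ wnorm v x :=
  Finset.sum_nonneg fun i _ => mul_nonneg (hv i) (abs_nonneg _)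

lemma wnorm_single (v : Fin d → ℝ) (y : ℝ) : wnorm v (Pi.single k y) = v k * |y| := by
  rw [wnorm, Finset.sum_eq_single k]
  · simp
  · intro j _ hj; simp [hj]
  · simp

lemma le_wnorm {v : Fin d → ℝ} (hv : ∀ i, 0 ≤ v i) (x : Fin d → ℝ) (i : Fin d) :
    v i * |x i| ≤ wnorm v x :=
  Finset.single_le_sum (f := fun i => v i * |x i|)
    (fun i _ => mul_nonneg (hv i) (abs_nonneg _)) (Finset.mem_univ i)

lemma cost_nonneg {T : ℕ} {h : List ℝ} (hh : ∀ q ∈ h, P.L ≤ q ∧ q ≤ P.U) {x : ℕ → Fin d → ℝ}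
    (hx : P.Feasible T x) : 0 ≤ P.cost T (P.inputOf k h) x := by
  refine add_nonneg (Finset.sum_nonneg fun t ht => ?_) (Finset.sum_nonneg fun t _ => ?_)
  · exact priceCost_nonneg (P.L_pos.le.trans (priceAt_mem P.L_lt_U.le hh t).1)
      fun i => ((hx.1 t ht).2 i).1
  · exact wnorm_nonneg P.w_nonneg _

lemma opt_le {T : ℕ} {h : List ℝ} (hh : ∀ q ∈ h, P.L ≤ q ∧ q ≤ P.U) {x : ℕ → Fin d → ℝ}
    (hx : P.Feasible T x) : P.opt T (P.inputOf k h) ≤ P.cost T (P.inputOf k h) x := by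
  refine csInf_le ⟨0, ?_⟩ ⟨x, hx, rfl⟩
  rintro v ⟨y, hy, rfl⟩
  exact cost_nonneg hh hy

lemma opt_nonneg {T : ℕ} {h : List ℝ} (hh : ∀ q ∈ h, P.L ≤ q ∧ q ≤ P.U) :
    0 ≤ P.opt T (P.inputOf k h) := by
  refine Real.sInf_nonneg ?_
  rintro v ⟨x, hx, rfl⟩
  exact cost_nonneg hh hx

/-- The condition `1 ≤ m * P.c k` keeps the coordinate `1 / (m * P.c k)` within `[0, 1]`. -/
lemma spread_feasible {T s m : ℕ} (hm : 0 < m) (hmc : 1 ≤ m * P.c k) (hT : s + m ≤ T) :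
    P.Feasible T (P.spread k s m) := by
  have hc := P.c_pos k
  have hm' : (1 : ℝ) ≤ m := by exact_mod_cast hm
  have hn : P.c k * |1 / (m * P.c k)| = 1 / m := by
    rw [abs_of_nonneg (by positivity)]; field_simp
  refine ⟨fun t _ => ?_, ?_⟩
  · unfold spread
    split_ifs
    · refine ⟨?_, fun i => ?_⟩
      · rw [X, Set.mem_ofPred_eq, wnorm_single, hn, div_le_one (by linarith)]
        exact hm'
      · by_cases hi : i = k
        · subst hi
          rw [Pi.single_eq_same, Set.mem_Icc, div_le_one (by positivity)]
          exact ⟨by positivity, hmc⟩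
        · simp [hi]
    · exact ⟨by simp [X, wnorm], by simp⟩
  · have h1 : ∑ t ∈ Finset.Ioc s (s + m), wnorm P.c (P.spread k s m t) = 1 := by
      rw [Finset.sum_congr rfl (g := fun _ => (1 / m : ℝ))]
      · rw [Finset.sum_const, Nat.card_Ioc, Nat.add_sub_cancel_left, nsmul_eq_mul]
        field_simp
      · intro t ht
        rw [spread, if_pos ht, wnorm_single, hn]
    rw [← h1]
    refine Finset.sum_le_sum_of_subset_of_nonneg ?_ fun t _ _ =>
      wnorm_nonneg (fun i => (P.c_pos i).le) _
    intro t ht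
    rw [Finset.mem_Ioc] at ht
    rw [Finset.mem_Icc]
    omega

/-- Switching is paid only on entering and on leaving the block, `β / m` each time, and so becomes
negligible for large `m`. -/
lemma cost_spread_le (hk : P.w k / P.c k = P.beta) {T s m : ℕ} (hm : 0 < m) (hT : s + m ≤ T)
    {p : ℝ} {h : List ℝ} (hp : ∀ t ∈ Finset.Ioc s (s + m), priceAt P.U h t = p) :
    P.cost T (P.inputOf k h) (P.spread k s m) ≤ p + 2 * P.beta / m := by
  have hc := P.c_pos k
  have hm' : (0 : ℝ) < m := by exact_mod_cast hm
  have hβ := P.beta_nonneg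
  refine add_le_add (le_of_eq ?_) ?_
  · have h1 : ∑ t ∈ Finset.Ioc s (s + m), P.inputOf k h t (P.spread k s m t) = p := by
      rw [Finset.sum_congr rfl (g := fun _ => (p / m : ℝ))]
      · rw [Finset.sum_const, Nat.card_Ioc, Nat.add_sub_cancel_left, nsmul_eq_mul]
        field_simp
      · intro t ht
        rw [spread, if_pos ht, inputOf, hp t ht, priceCost_single]
        field_simp
    rw [← h1]
    symm
    refine Finset.sum_subset ?_ fun t _ ht => ?_
    · intro t ht
      rw [Finset.mem_Ioc] at ht
      rw [Finset.mem_Icc]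
      omega
    · rw [spread, if_neg ht, inputOf, priceCost_zero]
  · have hw : P.w k * |1 / (m * P.c k)| = P.beta / m := by
      rw [abs_of_nonneg (by positivity), ← hk]; field_simp
    have h2 : ∀ t ∈ Finset.Icc 1 (T + 1),
        wnorm P.w (path T (P.spread k s m) t - path T (P.spread k s m) (t - 1)) ≤
          (if t = s + 1 then P.beta / m else 0) + (if t = s + m + 1 then P.beta / m else 0) := by
      have hpath : ∀ t, path T (P.spread k s m) t = P.spread k s m t := by
        intro t
        unfold path
        split_ifs with h3
        · rfl
        · rw [spread, if_neg]
          rw [Finset.mem_Icc] at h3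
          rw [Finset.mem_Ioc]
          omega
      intro t ht
      rw [Finset.mem_Icc] at ht
      rw [hpath, hpath]
      have hb : 0 ≤ P.beta / m := by positivity
      by_cases h3 : t ∈ Finset.Ioc s (s + m) <;> by_cases h4 : t - 1 ∈ Finset.Ioc s (s + m)
      · have : 0 ≤ (if t = s + 1 then P.beta / m else 0) +
            (if t = s + m + 1 then P.beta / m else 0) := by positivity
        simpa [spread, h3, h4, wnorm] using this
      · rw [spread, spread, if_pos h3, if_neg h4, sub_zero, wnorm_single, hw]
        rw [Finset.mem_Ioc] at h3 h4
        rw [if_pos (by omega)]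
        split_ifs <;> linarith
      · rw [spread, spread, if_neg h3, if_pos h4, zero_sub, ← Pi.single_neg, wnorm_single,
          abs_neg, hw]
        rw [Finset.mem_Ioc] at h3 h4
        rw [if_pos (show t = s + m + 1 by omega)]
        split_ifs <;> linarith
      · have : 0 ≤ (if t = s + 1 then P.beta / m else 0) +
            (if t = s + m + 1 then P.beta / m else 0) := by positivity
        simpa [spread, h3, h4, wnorm] using this
    refine (Finset.sum_le_sum h2).trans ?_
    rw [Finset.sum_add_distrib, Finset.sum_ite_eq' , Finset.sum_ite_eq', if_pos, if_pos]
    · apply le_of_eq; ring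
    · rw [Finset.mem_Icc]; omega
    · rw [Finset.mem_Icc]; omega

lemma isInstance_inputOf {T₀ T : ℕ} (hT₀ : T₀ ≤ T) {h : List ℝ}
    (hh : ∀ q ∈ h, P.L ≤ q ∧ q ≤ P.U) {x : ℕ → Fin d → ℝ} (hx : P.Feasible T x) :
    P.IsInstance T₀ T (P.inputOf k h) := by
  refine ⟨hT₀, fun t _ => ?_, x, hx⟩
  have := priceAt_mem P.L_lt_U.le hh t
  exact isCost_priceCost this.1 this.2

/-- The switching cost pays twice for every decrease of the amount bought in coordinate `k`. -/
lemma switching_ge (hk : P.w k / P.c k = P.beta) (T : ℕ) (x : ℕ → Fin d → ℝ) {g : ℕ → ℝ}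
    (hg : ∀ t, g t = P.c k * path T x t k) :
    2 * P.beta * ∑ t ∈ Finset.Icc 1 T, max 0 (g (t - 1) - g t) ≤
      ∑ t ∈ Finset.Icc 1 (T + 1), wnorm P.w (path T x t - path T x (t - 1)) := by
  have hβ := P.beta_nonneg
  have hc := P.c_pos k
  have h1 : ∀ t ∈ Finset.Icc 1 (T + 1), P.beta * (g t - g (t - 1)) +
      2 * P.beta * max 0 (g (t - 1) - g t) ≤
        wnorm P.w (path T x t - path T x (t - 1)) := by
    intro t _
    refine le_trans (le_of_eq ?_) (le_wnorm P.w_nonneg _ k)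
    have h2 : P.w k = P.beta * P.c k := by rw [← hk]; field_simp
    have h3 : P.c k * |(path T x t - path T x (t - 1)) k| = |g t - g (t - 1)| := by
      rw [hg, hg, ← mul_sub, abs_mul, abs_of_pos hc, Pi.sub_apply]
    rw [h2, mul_assoc P.beta, h3]
    rcases le_total (g t) (g (t - 1)) with h4 | h4
    · rw [max_eq_right (by linarith), abs_of_nonpos (by linarith)]; linarith
    · rw [max_eq_left (by linarith), abs_of_nonneg (by linarith)]; linarith
  refine le_trans ?_ (Finset.sum_le_sum h1)
  rw [Finset.sum_add_distrib, ← Finset.mul_sum, ← Finset.mul_sum]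
  -- With `|x| = x + 2 max 0 (-x)`, the signed part telescopes to zero since the path starts and
  -- ends at the origin.
  have h5 : ∑ t ∈ Finset.Icc 1 (T + 1), (g t - g (t - 1)) = 0 := by
    rw [sum_Icc_eq_sum_range]
    simp only [Nat.add_sub_cancel]
    rw [Finset.sum_range_sub, hg, hg]
    simp [path]
  rw [h5, mul_zero, zero_add, Finset.sum_Icc_succ_top (by omega)]
  have h6 : 0 ≤ max 0 (g (T + 1 - 1) - g (T + 1)) := le_max_left _ _
  exact mul_le_mul_of_nonneg_left (by linarith) (by linarith)

/-- The decisions on an input that extends the price history `h`, with advice that is zero along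
`h`, agree with the responses to `h`. -/
lemma response_eq {T₀ T : ℕ} {A : Alg d} (hA : P.Solves T₀ A) {h h' : List ℝ} {a : ℕ → Fin d → ℝ}
    (hT₀ : T₀ ≤ T) (hh' : ∀ q ∈ h', P.L ≤ q ∧ q ≤ P.U) (ha : P.Feasible T a) (hT : h.length ≤ T)
    (hs : h <:+ h') (ha0 : ∀ t ≤ h.length, a t = 0) :
    ∀ l, l <:+ h → P.response k T A l =
      P.c k * path T (A.act T (P.inputOf k h') a) l.length k := by
  intro l hl
  have hlen := hl.length_le
  unfold response
  split_ifs with h0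
  · subst h0
    simp [path]
  · have hpos : 0 < l.length := List.length_pos_of_ne_nil h0
    have hmem : l.length ∈ Finset.Icc 1 T := by rw [Finset.mem_Icc]; omega
    have h1 : A.act T (P.inputOf k l) 0 l.length = A.act T (P.inputOf k h') a l.length := by
      refine A.causal T _ _ _ _ _ hmem fun t ht => ?_
      rw [Finset.mem_Icc] at ht
      exact ⟨by rw [inputOf, inputOf, priceAt_suffix (hl.trans hs) ht.2],
        (ha0 t (ht.2.trans hlen)).symm⟩
    have hf := hA T _ (isInstance_inputOf (k := k) hT₀ hh' ha) a ha
    rw [h1, path, if_pos hmem, abs_of_nonneg ((hf.1 _ hmem).2 k).1]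

/-- Lower bounds on the total amount bought and on the cost of an algorithm in terms of its
responses to a price history `h`. -/
lemma cost_ge (hk : P.w k / P.c k = P.beta) {T₀ T : ℕ} {A : Alg d} (hA : P.Solves T₀ A)
    {h h' : List ℝ} {a : ℕ → Fin d → ℝ} (hT₀ : T₀ ≤ T) (hh' : ∀ q ∈ h', P.L ≤ q ∧ q ≤ P.U)
    (ha : P.Feasible T a) (hT : h.length ≤ T) (hs : h <:+ h') (ha0 : ∀ t ≤ h.length, a t = 0) :
    ∃ Q R : ℝ, 1 ≤ Q ∧ 0 ≤ R ∧ bought (P.response k T A) h + R ≤ Q ∧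
      P.U * Q - saving (P.response k T A) P.U (2 * P.beta) h - (P.U - P.L) * R ≤
        P.cost T (P.inputOf k h') (A.act T (P.inputOf k h') a) ∧
      (h' = h → P.U * Q - saving (P.response k T A) P.U (2 * P.beta) h ≤
        P.cost T (P.inputOf k h') (A.act T (P.inputOf k h') a)) := by
  have hres := response_eq (k := k) hA hT₀ hh' ha hT hs ha0
  have hf := hA T _ (isInstance_inputOf (k := k) hT₀ hh' ha) a ha
  set x := A.act T (P.inputOf k h') a with hx
  obtain ⟨g, hg⟩ : ∃ g : ℕ → ℝ, ∀ t, g t = P.c k * path T x t k := ⟨_, fun _ => rfl⟩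
  have hres' : ∀ l, l <:+ h → P.response k T A l = g l.length :=
    fun l hl => (hres l hl).trans (hg _).symm
  have hc := P.c_pos k
  have hβ := P.beta_nonneg
  have hgx : ∀ t ∈ Finset.Icc 1 T, g t = P.c k * x t k := by
    intro t ht
    rw [hg, path, if_pos ht]
  have hg0 : ∀ t ∈ Finset.Icc 1 T, 0 ≤ g t := by
    intro t ht
    rw [hgx t ht]
    exact mul_nonneg hc.le ((hf.1 t ht).2 k).1
  have hIoc : ∀ t ∈ Finset.Ioc h.length T, t ∈ Finset.Icc 1 T := by
    intro t ht
    rw [Finset.mem_Ioc] at ht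
    rw [Finset.mem_Icc]
    omega
  have hhit : ∑ t ∈ Finset.Icc 1 T, P.inputOf k h' t (x t) =
      P.U * ∑ t ∈ Finset.Icc 1 T, wnorm P.c (x t) -
        ∑ t ∈ Finset.Icc 1 T, (P.U - priceAt P.U h' t) * g t := by
    rw [Finset.mul_sum, ← Finset.sum_sub_distrib]
    refine Finset.sum_congr rfl fun t ht => ?_
    rw [inputOf, priceCost_eq _ fun i => ((hf.1 t ht).2 i).1, hgx t ht]
  have hsw := switching_ge hk T x hg
  have hsav := saving_eq_sum (U := P.U) (s := 2 * P.beta) hres'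
  rw [Finset.sum_sub_distrib, ← Finset.mul_sum] at hsav
  have hsav1 : ∑ t ∈ Finset.Icc 1 h.length, (P.U - priceAt P.U h t) * g t =
      ∑ t ∈ Finset.Icc 1 h.length, (P.U - priceAt P.U h' t) * g t := by
    refine Finset.sum_congr rfl fun t ht => ?_
    rw [Finset.mem_Icc] at ht
    rw [priceAt_suffix hs ht.2]
  have hsplit1 := sum_Icc_add_sum_Ioc (fun t => (P.U - priceAt P.U h' t) * g t) hT
  have hsplit2 := sum_Icc_add_sum_Ioc (fun t => max 0 (g (t - 1) - g t)) hT
  have hsplit3 := sum_Icc_add_sum_Ioc g hT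
  have hpos : 0 ≤ 2 * P.beta * ∑ t ∈ Finset.Ioc h.length T, max 0 (g (t - 1) - g t) :=
    mul_nonneg (by linarith) (Finset.sum_nonneg fun t _ => le_max_left _ _)
  have hmain : P.U * ∑ t ∈ Finset.Icc 1 T, wnorm P.c (x t) -
      saving (P.response k T A) P.U (2 * P.beta) h -
      ∑ t ∈ Finset.Ioc h.length T, (P.U - priceAt P.U h' t) * g t ≤
        P.cost T (P.inputOf k h') x := by
    rw [cost, hhit, ← hsplit1, hsav, hsav1]
    rw [← hsplit2, mul_add] at hsw
    linarith
  -- `Q` is the amount bought in all coordinates together, `R` the amount bought in coordinate `k`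
  -- after the history `h`.
  refine ⟨∑ t ∈ Finset.Icc 1 T, wnorm P.c (x t), ∑ t ∈ Finset.Ioc h.length T, g t, hf.2,
    Finset.sum_nonneg fun t ht => hg0 t (hIoc t ht), ?_, ?_, ?_⟩
  · rw [bought_eq_sum hres', hsplit3]
    refine Finset.sum_le_sum fun t ht => ?_
    rw [hgx t ht]
    exact (mul_le_mul_of_nonneg_left (le_abs_self _) hc.le).trans
      (le_wnorm (fun i => (P.c_pos i).le) _ k)
  · refine le_trans ?_ hmain
    have : ∑ t ∈ Finset.Ioc h.length T, (P.U - priceAt P.U h' t) * g t ≤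
        (P.U - P.L) * ∑ t ∈ Finset.Ioc h.length T, g t := by
      rw [Finset.mul_sum]
      refine Finset.sum_le_sum fun t ht => ?_
      have := (priceAt_mem P.L_lt_U.le hh' t).1
      exact mul_le_mul_of_nonneg_right (by linarith) (hg0 t (hIoc t ht))
    linarith
  · intro he
    have : ∑ t ∈ Finset.Ioc h.length T, (P.U - priceAt P.U h' t) * g t = 0 := by
      refine Finset.sum_eq_zero fun t ht => ?_
      rw [Finset.mem_Ioc] at ht
      rw [he, priceAt_of_length_lt ht.1, sub_self, zero_mul]
    linarith

/-! ### Robustness and consistency as inequalities in the price game -/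

lemma spread_eq_zero {s m t : ℕ} (ht : t ≤ s) : P.spread k s m t = 0 := by
  rw [spread, if_neg]
  rw [Finset.mem_Ioc]
  omega

/-- Every unit costs at least `L`, while spreading the purchase after `h` at price `U` bounds the
optimum. -/
lemma bought_le_of_robust (hk : P.w k / P.c k = P.beta) {T₀ T m : ℕ} {A : Alg d} {r₀ r : ℝ}
    (hA : P.Solves T₀ A) (hR : P.Robust T₀ A r₀) (hr₀ : r₀ ≤ r) (hr : 0 ≤ r)
    (hT₀ : T₀ ≤ T) (hm : 0 < m)
    (hmc : 1 ≤ m * P.c k) {h : List ℝ} (hT : h.length + m ≤ T)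
    (hh : ∀ q ∈ h, P.L ≤ q ∧ q ≤ P.U) :
    P.L * bought (P.response k T A) h ≤ r * (P.U + 2 * P.beta / m) := by
  have ha := spread_feasible (s := h.length) hm hmc hT
  obtain ⟨Q, R, h1, h2, h3, -, h5⟩ := cost_ge hk hA hT₀ hh ha (by omega) (List.suffix_refl h)
    fun t ht => spread_eq_zero ht
  have h6 := (hR T _ (isInstance_inputOf (k := k) hT₀ hh ha) _ ha).trans
    (mul_le_mul_of_nonneg_right hr₀ (opt_nonneg hh))
  have h7 := (opt_le (k := k) hh ha).trans (cost_spread_le hk hm hT (p := P.U) fun t ht =>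
    priceAt_of_length_lt (Finset.mem_Ioc.1 ht).1)
  have h8 := mul_le_mul_of_nonneg_left h7 hr
  have h9 := saving_le (L := P.L) (response_nonneg (P := P) (k := k) T A)
    (by linarith [P.beta_nonneg] : 0 ≤ 2 * P.beta) hh
  have h10 := h5 rfl
  have h11 := P.L_pos.trans P.L_lt_U
  have h12 : P.U * bought (P.response k T A) h ≤ P.U * Q :=
    mul_le_mul_of_nonneg_left (by linarith) h11.le
  linarith

/-- The optimum may spread its purchase over the last `m` steps at price `p`. The advice instead
buys after the history, at price `U`, so that it reveals nothing along it. -/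
lemma saving_ge_of_robust (hk : P.w k / P.c k = P.beta) {T₀ T m : ℕ} {A : Alg d} {r₀ r : ℝ}
    (hA : P.Solves T₀ A) (hR : P.Robust T₀ A r₀) (hr₀ : r₀ ≤ r) (hr : 0 ≤ r)
    (hT₀ : T₀ ≤ T) (hm : 0 < m)
    (hmc : 1 ≤ m * P.c k) {p : ℝ} {h : List ℝ} (hT : (List.replicate m p ++ h).length + m ≤ T)
    (hp : P.L ≤ p) (hpU : p ≤ P.U) (hh : ∀ q ∈ h, P.L ≤ q ∧ q ≤ P.U) :
    P.U - r * (p + 2 * P.beta / m) ≤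
      saving (P.response k T A) P.U (2 * P.beta) (List.replicate m p ++ h) := by
  have hh' : ∀ q ∈ List.replicate m p ++ h, P.L ≤ q ∧ q ≤ P.U := by
    intro q hq
    rcases List.mem_append.1 hq with hq | hq
    · rw [List.eq_of_mem_replicate hq]; exact ⟨hp, hpU⟩
    · exact hh q hq
  have ha := spread_feasible (s := (List.replicate m p ++ h).length) hm hmc hT
  obtain ⟨Q, R, h1, h2, h3, -, h5⟩ := cost_ge hk hA hT₀ hh' ha (by omega) (List.suffix_refl _)
    fun t ht => spread_eq_zero ht
  have h6 := (hR T _ (isInstance_inputOf (k := k) hT₀ hh' ha) _ ha).trans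
    (mul_le_mul_of_nonneg_right hr₀ (opt_nonneg hh'))
  have hT' : h.length + m ≤ T := by
    rw [List.length_append, List.length_replicate] at hT; omega
  have h7 := (opt_le (k := k) hh' (spread_feasible hm hmc hT')).trans
    (cost_spread_le hk hm hT' fun t ht => priceAt_replicate ht)
  have h8 := mul_le_mul_of_nonneg_left h7 hr
  have h10 := h5 rfl
  have h11 := mul_le_mul_of_nonneg_left h1 (P.L_pos.trans P.L_lt_U).le
  linarith

/-- The price `L` and the purchases of the advice both come after `h`. Even if the algorithm then
buys all the rest at `L`, it pays at least `L + (U - L) * bought - saving`. -/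
lemma bought_sub_saving_le_of_consistent (hk : P.w k / P.c k = P.beta) {T₀ T m : ℕ} {A : Alg d}
    {b : ℝ} (hA : P.Solves T₀ A) (hC : P.Consistent T₀ A b) (hT₀ : T₀ ≤ T) (hm : 0 < m)
    (hmc : 1 ≤ m * P.c k) {h : List ℝ} (hT : h.length + m ≤ T)
    (hh : ∀ q ∈ h, P.L ≤ q ∧ q ≤ P.U) :
    (P.U - P.L) * bought (P.response k T A) h -
      saving (P.response k T A) P.U (2 * P.beta) h ≤ b * (P.L + 2 * P.beta / m) - P.L := by
  have hLU := P.L_lt_U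
  have hh' : ∀ q ∈ List.replicate m P.L ++ h, P.L ≤ q ∧ q ≤ P.U := by
    intro q hq
    rcases List.mem_append.1 hq with hq | hq
    · rw [List.eq_of_mem_replicate hq]; exact ⟨le_rfl, hLU.le⟩
    · exact hh q hq
  have ha := spread_feasible (s := h.length) hm hmc hT
  obtain ⟨Q, R, h1, h2, h3, h4, -⟩ := cost_ge hk hA hT₀ hh' ha (by omega)
    (List.suffix_append _ _) fun t ht => spread_eq_zero ht
  have h6 := hC T _ (isInstance_inputOf (k := k) hT₀ hh' ha) _ ha
  have h7 := cost_spread_le hk hm hT (p := P.L)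
    (h := List.replicate m P.L ++ h) fun t ht => priceAt_replicate ht
  have h8 := cost_nonneg (k := k) hh' ha
  have h9 := saving_le (L := P.L) (response_nonneg (P := P) (k := k) T A)
    (by linarith [P.beta_nonneg] : 0 ≤ 2 * P.beta) hh
  have h10 : (P.U - P.L) * (bought (P.response k T A) h + R) ≤ (P.U - P.L) * Q :=
    mul_le_mul_of_nonneg_left h3 (by linarith)
  have h11 := mul_le_mul_of_nonneg_left h1 P.L_pos.le
  -- The algorithm pays at least `L > 0`, which a negative `b` would contradict.
  have hb : 0 ≤ b := by
    by_contra hb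
    push Not at hb
    have := mul_nonpos_of_nonpos_of_nonneg hb.le h8
    have := P.L_pos
    nlinarith
  have h12 := mul_le_mul_of_nonneg_left h7 hb
  linarith

end Cost

end CFL

/-! ### The trade-off inequality and its limit -/

namespace CFL

variable {d : ℕ} {P : CFL d} {k : Fin d}

/-- The finite-horizon trade-off between consistency `b` and robustness `r`, with an error term
that vanishes as the number `n` of price levels grows. -/
lemma tradeoff_of_levels (hk : P.w k / P.c k = P.beta) {T₀ : ℕ} {A : Alg d} {b r₀ r : ℝ}
    (hA : P.Solves T₀ A) (hC : P.Consistent T₀ A b) (hR : P.Robust T₀ A r₀) (hr₀ : r₀ ≤ r)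
    (hr : 0 < r)
    (hr0 : 0 < P.U - 2 * P.beta - P.U / r) (hrU : P.L ≤ P.U / r) {n : ℕ} (hn : 0 < n)
    (hnc : 1 ≤ n * P.c k) {e : ℝ} (he : e = 1 / n) :
    (P.U - P.L) * (r * Real.log ((P.U - 2 * P.beta - P.L + 2 * P.beta * e) /
        (P.U - 2 * P.beta - P.U / r + 2 * P.beta * e)) -
      e * (r * ((P.U / r - P.L) ^ 2 / (P.U - 2 * P.beta - P.U / r) ^ 2) +
        2 * P.beta / (P.U - 2 * P.beta - P.U / r)) -
      (2 * P.beta * e ^ 2 + r * (2 * P.beta * e)) / (P.U - 2 * P.beta - P.U / r)) -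
      (r * (P.U / r - P.L) - r * (2 * P.beta * e)) ≤ b * (P.L + 2 * P.beta * e) - P.L := by
  have hn' : (0 : ℝ) < n := by exact_mod_cast hn
  have hβ := P.beta_nonneg
  have hLU := P.L_lt_U
  have hL := P.L_pos
  have he0 : 0 < e := by rw [he]; positivity
  have hdiv : ∀ y : ℝ, y / n = y * e := fun y => by rw [he]; ring
  have hs : 0 ≤ 2 * P.beta := by linarith
  set p₀ := P.U / r with hp₀
  obtain ⟨N, hN⟩ := exists_nat_gt (2 * P.beta / (P.U - 2 * P.beta - p₀))
  have hN0 : (0 : ℝ) < N := lt_of_le_of_lt (by positivity) hN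
  have hNp : 2 * P.beta / N ≤ P.U - 2 * P.beta - p₀ := by
    rw [div_lt_iff₀ hr0] at hN
    rw [div_le_iff₀ hN0]
    linarith
  have hθ : 0 < e ^ 2 * (e / (1 + e)) ^ n := by positivity
  obtain ⟨j, hj⟩ := exists_nat_gt (r * (P.U + 2 * P.beta / n) / P.L / (e ^ 2 * (e / (1 + e)) ^ n))
  rw [div_lt_iff₀ hθ] at hj
  have hnδ : n * ((p₀ - P.L) * e) = p₀ - P.L := by rw [he]; field_simp
  have hδ : 0 ≤ (p₀ - P.L) * e := mul_nonneg (by linarith) he0.le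
  set M := (n + 1) * (j * (n + N) + n) with hM
  -- `T` is chosen last, long enough for the longest possible game and a block of advice after it.
  -- The size of `j` is harmless, because the bounds used do not depend on `T`.
  obtain ⟨T, hT₀, hT⟩ : ∃ T, T₀ ≤ T ∧ M + n ≤ T := 
    ⟨max T₀ (M + n), le_max_left _ _, le_max_right _ _⟩
  -- The choice `κ = e ^ 2` makes the losses `2β κ` over `n = 1 / e` levels add up to order `e`; `ρ
  -- = e` merely shifts the saving rates by `2β e`.
  obtain ⟨h, h1, h2, h3, h4⟩ := exists_history (U := P.U) (response_nonneg (P := P) (k := k) T A) hs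
    (L := P.L) (ρ := e) (κ := e ^ 2) (p₀ := p₀) (δ := (p₀ - P.L) * e) (r := r)
    (η := r * (2 * P.beta * e)) (Q := r * (P.U + 2 * P.beta / n) / P.L) he0 (by positivity)
    (by exact_mod_cast hN0) hNp hr0 hr.le (by positivity) hδ hLU.le (by linarith) n n j
    (by linarith) hj
    (fun h h1 h2 => by
      rw [le_div_iff₀ hL, mul_comm]
      exact bought_le_of_robust hk hA hR hr₀ hr.le hT₀ hn hnc (by omega) h2)
    (fun p h h1 h2 h3 h4 => by
      refine le_trans (le_of_eq ?_) (saving_ge_of_robust hk hA hR hr₀ hr.le hT₀ hn hnc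
        (p := p) (h := h) (by omega) h2 h3 h4)
      rw [hdiv]
      have : r * p₀ = P.U := by rw [hp₀]; field_simp
      linarith) n le_rfl
  have h5 := bought_sub_saving_le_of_consistent hk hA hC hT₀ hn hnc (h := h) (by omega) h2
  rw [hnδ] at h3 h4
  rw [hdiv] at h5
  have e1 : P.U - 2 * P.beta - p₀ + (p₀ - P.L) + 2 * P.beta * e =
      P.U - 2 * P.beta - P.L + 2 * P.beta * e := by ring
  have e2 : n * (r * (((p₀ - P.L) * e) ^ 2 / (P.U - 2 * P.beta - p₀) ^ 2) +
      2 * P.beta * e ^ 2 / (P.U - 2 * P.beta - p₀)) =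
      e * (r * ((p₀ - P.L) ^ 2 / (P.U - 2 * P.beta - p₀) ^ 2) +
        2 * P.beta / (P.U - 2 * P.beta - p₀)) := by
    have : n * e = 1 := by rw [he]; field_simp
    calc _ = (n * e) * (e * (r * ((p₀ - P.L) ^ 2 / (P.U - 2 * P.beta - p₀) ^ 2) +
        2 * P.beta / (P.U - 2 * P.beta - p₀))) := by ring
      _ = _ := by rw [this, one_mul]
  rw [e1, e2] at h4
  have hK : 0 < P.U - 2 * P.beta - P.L + 2 * P.beta * e := by
    have := P.two_mul_beta_lt
    have : 0 ≤ 2 * P.beta * e := by positivity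
    linarith
  -- Saving beyond the forced level does not help the algorithm: the purchase it needs weighs at
  -- least as much, as `U - L` is at least the saving rate when `e ≤ 1`.
  have h6 : saving (P.response k T A) P.U (2 * P.beta) h -
        (r * (p₀ - P.L) - r * (2 * P.beta * e)) ≤
      (P.U - P.L) * ((saving (P.response k T A) P.U (2 * P.beta) h -
        (r * (p₀ - P.L) - r * (2 * P.beta * e))) /
          (P.U - 2 * P.beta - P.L + 2 * P.beta * e)) := by
    rw [← mul_div_assoc, le_div_iff₀ hK, mul_comm]
    refine mul_le_mul_of_nonneg_right ?_ (by linarith)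
    have he1 : e ≤ 1 := by
      rw [he, div_le_one hn']; exact_mod_cast hn
    have := mul_le_mul_of_nonneg_left he1 hs
    linarith
  have h7 := mul_le_mul_of_nonneg_left h4 (by linarith : 0 ≤ P.U - P.L)
  linarith

open Filter Topology in
/-- The trade-off between consistency `b` and robustness `r`. -/
theorem tradeoff [NeZero d] {T₀ : ℕ} {A : Alg d} {b r₀ r : ℝ}
    (hA : P.Solves T₀ A) (hC : P.Consistent T₀ A b) (hR : P.Robust T₀ A r₀) (hr₀ : r₀ ≤ r)
    (hr : 0 < r)
    (hr0 : 0 < P.U - P.U / r - 2 * P.beta) (hrU : r ≤ P.U / P.L) :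
    r + r / P.L * (P.U - P.L) *
        Real.log ((P.U - P.L - 2 * P.beta) / (P.U - P.U / r - 2 * P.beta)) - P.U / P.L ≤
      b - 1 := by
  obtain ⟨k, hk⟩ := exists_eq_ciSup_of_finite (f := fun i => P.w i / P.c i)
  have hL := P.L_pos
  have hK := P.two_mul_beta_lt
  have hr0' : 0 < P.U - 2 * P.beta - P.U / r := by linarith
  have hrU' : P.L ≤ P.U / r := by
    rw [le_div_iff₀ hr, mul_comm]; rwa [le_div_iff₀ hL] at hrU
  have hev : ∀ᶠ n : ℕ in atTop, 0 < n ∧ 1 ≤ n * P.c k := by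
    refine (eventually_gt_atTop 0).and ?_
    have : Tendsto (fun n : ℕ => n * P.c k) atTop atTop :=
      tendsto_natCast_atTop_atTop.atTop_mul_const (P.c_pos k)
    exact this.eventually_ge_atTop 1
  have hcont : ContinuousAt (fun e : ℝ =>
      (P.U - P.L) * (r * Real.log ((P.U - 2 * P.beta - P.L + 2 * P.beta * e) /
        (P.U - 2 * P.beta - P.U / r + 2 * P.beta * e)) -
      e * (r * ((P.U / r - P.L) ^ 2 / (P.U - 2 * P.beta - P.U / r) ^ 2) +
        2 * P.beta / (P.U - 2 * P.beta - P.U / r)) -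
      (2 * P.beta * e ^ 2 + r * (2 * P.beta * e)) / (P.U - 2 * P.beta - P.U / r)) -
      (r * (P.U / r - P.L) - r * (2 * P.beta * e)) - (b * (P.L + 2 * P.beta * e) - P.L)) 0 := by
    have h1 : P.U - 2 * P.beta - P.U / r + 2 * P.beta * 0 ≠ 0 := by
      rw [mul_zero, add_zero]; exact hr0'.ne'
    have h2 : (P.U - 2 * P.beta - P.L + 2 * P.beta * 0) /
        (P.U - 2 * P.beta - P.U / r + 2 * P.beta * 0) ≠ 0 := by
      refine div_ne_zero ?_ h1
      rw [mul_zero, add_zero]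
      linarith
    fun_prop (disch := assumption)
  have hlim := hcont.tendsto.comp (tendsto_one_div_atTop_nhds_zero_nat (𝕜 := ℝ))
  have h0 := le_of_tendsto (b := (0 : ℝ)) hlim (hev.mono fun n hn => by
    have := tradeoff_of_levels hk hA hC hR hr₀ hr hr0' hrU' hn.1 hn.2 rfl
    simp only [Function.comp]
    linarith)
  simp only [mul_zero, add_zero, zero_mul, sub_zero, ne_eq, OfNat.ofNat_ne_zero,
    not_false_eq_true, zero_pow, zero_div] at h0
  have e1 : r * (P.U / r - P.L) = P.U - r * P.L := by field_simp
  rw [e1, sub_right_comm P.U (2 * P.beta) P.L, sub_right_comm P.U (2 * P.beta) (P.U / r)] at h0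
  generalize Real.log ((P.U - P.L - 2 * P.beta) / (P.U - P.U / r - 2 * P.beta)) = l at *
  have e2 : r + r / P.L * (P.U - P.L) * l - P.U / P.L =
      (r * P.L + (P.U - P.L) * (r * l) - P.U) / P.L := by field_simp
  rw [e2, div_le_iff₀ hL]
  linarith

end CFL

/-! ### The surplus function, `α` and `γ` -/

namespace CFL

variable {d : ℕ} {P : CFL d}

/-- The consistency surplus that is forced by robustness `r`. -/
noncomputable def surplus (P : CFL d) (r : ℝ) : ℝ :=
  r + r / P.L * (P.U - P.L) *
    Real.log ((P.U - P.L - 2 * P.beta) / (P.U - P.U / r - 2 * P.beta)) - P.U / P.L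

lemma surplus_top (P : CFL d) : P.surplus (P.U / P.L) = 0 := by
  have hL := P.L_pos
  have hU := hL.trans P.L_lt_U
  have hK := P.two_mul_beta_lt
  have h1 : P.U / (P.U / P.L) = P.L := by field_simp
  rw [surplus, h1, div_self (by linarith), Real.log_one]
  ring

/-- Strict descent of `surplus` from a nonnegative value: it is convex and vanishes at `U / L`. -/
lemma surplus_lt_of_lt {x y : ℝ} (hx : 0 < x) (hx0 : 0 < P.U - P.U / x - 2 * P.beta) (hxy : x < y)
    (hy : y < P.U / P.L) {ε : ℝ} (hε : 0 < ε) (h : P.surplus x ≤ ε) : P.surplus y < ε := by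
  have hL := P.L_pos
  have hLU := P.L_lt_U
  have hU := hL.trans hLU
  have hK : 0 < P.U - P.L - 2 * P.beta := by linarith [P.two_mul_beta_lt]
  have hy0 : 0 < y := hx.trans hxy
  set z := P.U / P.L with hz
  have hz0 : 0 < z := by positivity
  have hUz : P.U / z = P.L := by rw [hz]; field_simp
  set a := (z - y) / (z - x) with ha
  set c := (y - x) / (z - x) with hc
  have hzx : 0 < z - x := by linarith
  have ha0 : 0 < a := div_pos (by linarith) hzx
  have hc0 : 0 < c := div_pos (by linarith) hzx
  have hac : a + c = 1 := by rw [ha, hc]; field_simp; ring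
  have hyac : a * x + c * z = y := by rw [ha, hc]; field_simp; ring
  -- Multiplied by its argument, `U - U / x - 2β` becomes affine, so concavity of `log` with weights
  -- `a x / y` and `c z / y` gives convexity of the logarithmic term of `surplus` (a perspective
  -- function).
  have hDy : a * x / y * (P.U - P.U / x - 2 * P.beta) + c * z / y * (P.U - P.L - 2 * P.beta) =
      P.U - P.U / y - 2 * P.beta := by
    have h1 : a * x / y * (P.U - P.U / x - 2 * P.beta) + c * z / y * (P.U - P.L - 2 * P.beta) =
        ((a * x + c * z) * (P.U - 2 * P.beta) - (a + c) * P.U) / y := by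
      rw [← hUz]; field_simp; ring
    rw [h1, hyac, hac]
    field_simp; ring
  have hw1 : a * x / y + c * z / y = 1 := by rw [← add_div, hyac, div_self hy0.ne']
  have hlog := strictConcaveOn_log_Ioi.concaveOn.2 (Set.mem_Ioi.2 hx0) (Set.mem_Ioi.2 hK)
    (by positivity : 0 ≤ a * x / y) (by positivity : 0 ≤ c * z / y) hw1
  simp only [smul_eq_mul] at hlog
  rw [hDy] at hlog
  have hDy0 : 0 < P.U - P.U / y - 2 * P.beta := by rw [← hDy]; positivity
  unfold surplus at h ⊢
  rw [Real.log_div hK.ne' hx0.ne'] at h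
  rw [Real.log_div hK.ne' hDy0.ne']
  generalize Real.log (P.U - P.U / x - 2 * P.beta) = lx at *
  generalize Real.log (P.U - P.L - 2 * P.beta) = lz at *
  generalize Real.log (P.U - P.U / y - 2 * P.beta) = ly at *
  have h2 : y * (lz - ly) ≤ a * x * (lz - lx) := by
    have h3 := mul_le_mul_of_nonneg_left hlog hy0.le
    have h4 : y * (a * x / y * lx + c * z / y * lz) = a * x * lx + c * z * lz := by field_simp
    rw [h4] at h3
    have h5 : y * lz = a * x * lz + c * z * lz := by rw [← hyac]; ring
    linarith
  have h6 : y / P.L * (P.U - P.L) * (lz - ly) ≤ a * (x / P.L * (P.U - P.L) * (lz - lx)) := by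
    have h7 := mul_le_mul_of_nonneg_left h2 (div_pos (sub_pos.2 hLU) hL).le
    have e1 : (P.U - P.L) / P.L * (y * (lz - ly)) = y / P.L * (P.U - P.L) * (lz - ly) := by ring
    have e2 : (P.U - P.L) / P.L * (a * x * (lz - lx)) =
        a * (x / P.L * (P.U - P.L) * (lz - lx)) := by ring
    linarith
  have h8 := mul_le_mul_of_nonneg_left h ha0.le
  have h9 : a * ε < ε := by nlinarith
  have h10 : z = a * z + c * z := by rw [← add_mul, hac, one_mul]
  linarith

/-- In `y = 1 / α` the equation is `exp y * (U - U y - 2β) = U - L - 2β`. The left side has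
derivative `-exp y * (U y + 2β)`, and falls from `U - 2β` at `0` to a nonpositive value at `1`. -/
lemma existsUnique_isAlpha (P : CFL d) : ∃! α : ℝ, P.IsAlpha α := by
  have hL := P.L_pos
  have hLU := P.L_lt_U
  have hU := hL.trans hLU
  have hβ := P.beta_nonneg
  have hK : 0 < P.U - P.L - 2 * P.beta := by linarith [P.two_mul_beta_lt]
  have hiff : ∀ α : ℝ, P.IsAlpha α → P.U - P.L - 2 * P.beta =
      Real.exp (1 / α) * (P.U - P.U * (1 / α) - 2 * P.beta) := by
    rintro α ⟨h0, h⟩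
    have hD : P.U - P.U / α - 2 * P.beta ≠ 0 := by
      -- A zero denominator would make the quotient `0` by convention, which is no value of `exp`.
      intro h1
      rw [h1, div_zero] at h
      exact (Real.exp_pos _).ne h
    rw [div_eq_iff hD] at h
    rwa [mul_one_div]
  have hmono : ∀ x y : ℝ, 0 < x → x < y → 0 < P.U - P.U * x - 2 * P.beta →
      Real.exp y * (P.U - P.U * y - 2 * P.beta) < Real.exp x * (P.U - P.U * x - 2 * P.beta) := by
    intro x y hx hxy hD
    have h1 : P.U - P.U * y - 2 * P.beta < Real.exp (x - y) * (P.U - P.U * x - 2 * P.beta) := by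
      have h2 := mul_le_mul_of_nonneg_right (Real.add_one_le_exp (x - y)) hD.le
      have h3 : 0 < (y - x) * (P.U * x + 2 * P.beta) := by
        have := mul_pos hU hx
        exact mul_pos (by linarith) (by linarith)
      linarith
    have h4 := mul_lt_mul_of_pos_left h1 (Real.exp_pos y)
    rwa [← mul_assoc, ← Real.exp_add, add_sub_cancel] at h4
  have hpos : ∀ α, P.IsAlpha α → 0 < P.U - P.U * (1 / α) - 2 * P.beta := fun α h =>
    pos_of_mul_pos_right (hiff α h ▸ hK) (Real.exp_pos _).le
  obtain ⟨y, hy, hyK⟩ : ∃ y ∈ Set.Icc (0 : ℝ) 1,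
      Real.exp y * (P.U - P.U * y - 2 * P.beta) = P.U - P.L - 2 * P.beta := by
    refine intermediate_value_Icc' zero_le_one (by fun_prop) ⟨?_, ?_⟩
    · have : 0 ≤ Real.exp 1 * (2 * P.beta) := by positivity
      have e : Real.exp 1 * (P.U - P.U * 1 - 2 * P.beta) = -(Real.exp 1 * (2 * P.beta)) := by ring
      rw [e]; linarith
    · simp only [Real.exp_zero, mul_zero]; linarith
  have hy0 : 0 < y := by
    refine lt_of_le_of_ne hy.1 fun h => ?_
    rw [← h, Real.exp_zero] at hyK
    linarith
  refine ⟨1 / y, ⟨by positivity, ?_⟩, fun α hα => ?_⟩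
  · have hD : 0 < P.U - P.U * y - 2 * P.beta :=
      pos_of_mul_pos_right (hyK ▸ hK) (Real.exp_pos _).le
    rw [one_div_one_div, div_div_eq_mul_div, div_one, ← hyK, mul_div_assoc, div_self hD.ne', mul_one]
  · have h1 := hiff α hα
    have h2 := hpos α hα
    have hα0 : 0 < 1 / α := one_div_pos.2 hα.1
    have hD : 0 < P.U - P.U * y - 2 * P.beta :=
      pos_of_mul_pos_right (hyK ▸ hK) (Real.exp_pos _).le
    rw [eq_div_iff hy0.ne', mul_comm]
    rw [← div_left_inj' hα.1.ne', mul_div_assoc, div_self hα.1.ne', mul_one]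
    rcases lt_trichotomy y (1 / α) with h | h | h
    · have := hmono _ _ hy0 h hD; linarith
    · exact h
    · have := hmono _ _ hα0 h h2; linarith

namespace IsAlpha

variable {α : ℝ}

lemma denom_pos (h : P.IsAlpha α) : 0 < P.U - P.U / α - 2 * P.beta := by
  have hK : 0 < P.U - P.L - 2 * P.beta := by linarith [P.two_mul_beta_lt]
  have := h.2 ▸ Real.exp_pos (1 / α)
  exact (pos_iff_pos_of_mul_pos (by
    rw [div_eq_mul_inv] at this
    exact mul_pos hK (inv_pos.1 (pos_of_mul_pos_right this hK.le)))).1 hK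

lemma lt_top (h : P.IsAlpha α) : α < P.U / P.L := by
  have hK : 0 < P.U - P.L - 2 * P.beta := by linarith [P.two_mul_beta_lt]
  have h1 : 1 < Real.exp (1 / α) := Real.one_lt_exp_iff.2 (one_div_pos.2 h.1)
  rw [← h.2, one_lt_div h.denom_pos] at h1
  have h2 : P.L < P.U / α := by linarith
  rw [lt_div_iff₀ h.1] at h2
  rw [lt_div_iff₀ P.L_pos]
  linarith

lemma surplus_eq (h : P.IsAlpha α) : P.surplus α = α - 1 := by
  have hL := P.L_pos
  have hα := h.1
  rw [surplus, h.2, Real.log_exp]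
  field_simp; ring

lemma denom_pos_of_le (h : P.IsAlpha α) {x : ℝ} (hx : α ≤ x) :
    0 < P.U - P.U / x - 2 * P.beta := by
  have h1 := h.denom_pos
  have h2 : P.U / x ≤ P.U / α :=
    div_le_div_of_nonneg_left (P.L_pos.trans P.L_lt_U).le h.1 hx
  linarith

lemma isGamma_iff {ε γ : ℝ} :
    P.IsGamma α ε γ ↔ γ ∈ Set.Icc α (P.U / P.L) ∧ P.surplus γ = ε := by
  unfold IsGamma surplus
  constructor
  · rintro ⟨h1, h2⟩; exact ⟨h1, by linarith⟩
  · rintro ⟨h1, h2⟩; exact ⟨h1, by linarith⟩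

lemma isGamma_lt_top {ε γ : ℝ} (hε : 0 < ε) (hγ : P.IsGamma α ε γ) : γ < P.U / P.L := by
  rw [isGamma_iff] at hγ
  refine lt_of_le_of_ne hγ.1.2 ?_
  rintro rfl
  rw [surplus_top] at hγ
  exact hε.ne hγ.2

lemma existsUnique_isGamma (h : P.IsAlpha α) {ε : ℝ} (hε : 0 < ε) (hεα : ε ≤ α - 1) :
    ∃! γ : ℝ, P.IsGamma α ε γ := by
  have hα := h.1
  have hK : 0 < P.U - P.L - 2 * P.beta := by linarith [P.two_mul_beta_lt]
  have hcont : ContinuousOn P.surplus (Set.Icc α (P.U / P.L)) := by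
    intro x hx
    have h1 := h.denom_pos_of_le hx.1
    have h2 : (P.U - P.L - 2 * P.beta) / (P.U - P.U / x - 2 * P.beta) ≠ 0 := by positivity
    have h1' := h1.ne'
    have h3 : x ≠ 0 := (hα.trans_le hx.1).ne'
    have : ContinuousAt P.surplus x := by
      unfold surplus
      fun_prop (disch := assumption)
    exact this.continuousWithinAt
  obtain ⟨γ, hγ, hγε⟩ : ∃ γ ∈ Set.Icc α (P.U / P.L), P.surplus γ = ε := by
    refine intermediate_value_Icc' h.lt_top.le hcont ⟨?_, ?_⟩
    · rw [surplus_top]; exact hε.le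
    · rw [h.surplus_eq]; exact hεα
  have hγ' : P.IsGamma α ε γ := isGamma_iff.2 ⟨hγ, hγε⟩
  have hlt : ∀ x y, P.IsGamma α ε x → P.IsGamma α ε y → ¬ x < y := by
    intro x y hx hy hxy
    have hy1 := isGamma_lt_top hε hy
    rw [isGamma_iff] at hx hy
    have := surplus_lt_of_lt (hα.trans_le hx.1.1) (h.denom_pos_of_le hx.1.1) hxy hy1 hε hx.2.le
    exact this.ne hy.2
  refine ⟨γ, hγ', fun x hx => ?_⟩
  rcases lt_trichotomy x γ with h1 | h1 | h1
  · exact (hlt _ _ hx hγ' h1).elim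
  · exact h1
  · exact (hlt _ _ hγ' hx h1).elim

end IsAlpha

/-- Robustness below the target `γ` is incompatible with consistency at most `1 + ε`. -/
lemma le_of_consistent_of_robust [NeZero d] {α ε γ : ℝ} (hα : P.IsAlpha α) (hε : 0 < ε)
    (hγ : P.IsGamma α ε γ) {T₀ : ℕ} {A : Alg d} (hA : P.Solves T₀ A) {b r : ℝ} (hb : b ≤ 1 + ε)
    (hC : P.Consistent T₀ A b) (hR : P.Robust T₀ A r) : γ ≤ r := by
  by_contra! hlt
  have hL := P.L_pos
  have hLU := P.L_lt_U
  have hγtop := IsAlpha.isGamma_lt_top hε hγ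
  have hγ' := IsAlpha.isGamma_iff.1 hγ
  have hγ0 : 0 < γ := hα.1.trans_le hγ'.1.1
  have hD := hα.denom_pos_of_le hγ'.1.1
  have ha : 0 < P.U - 2 * P.beta := by linarith [P.two_mul_beta_lt]
  have hγm : P.U / (P.U - 2 * P.beta) < γ := by
    rw [div_lt_iff₀ ha]
    have : P.U / γ < P.U - 2 * P.beta := by linarith
    rw [div_lt_iff₀ hγ0] at this
    linarith
  -- The given `r` may be so small that the denominator inside the logarithm is not positive.
  -- Robustness only weakens when the factor increases, so it is raised to some `x < γ` beyond `U /
  -- (U - 2β)`.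
  obtain ⟨x, hx1, hx2⟩ := exists_between (max_lt hlt hγm)
  rw [max_lt_iff] at hx1
  have hx0 : 0 < x := lt_trans (div_pos (hL.trans hLU) ha) hx1.2
  have hDx : 0 < P.U - P.U / x - 2 * P.beta := by
    have := hx1.2
    rw [div_lt_iff₀ ha] at this
    have : P.U / x < P.U - 2 * P.beta := by rw [div_lt_iff₀ hx0]; linarith
    linarith
  have h1 : P.surplus x ≤ b - 1 :=
    tradeoff hA hC hR hx1.1.le hx0 hDx (hx2.trans hγtop).le
  have h2 := surplus_lt_of_lt hx0 hDx hx2 hγtop hε (by linarith)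
  exact h2.ne hγ'.2

end CFL

theorem theorem4p4 {d : ℕ} [NeZero d] (P : CFL d) (T₀ : ℕ) :
    (∃! α : ℝ, P.IsAlpha α) ∧
    ∀ α : ℝ, P.IsAlpha α → ∀ ε : ℝ, 0 < ε → ε ≤ α - 1 →
      (∃! γ : ℝ, P.IsGamma α ε γ) ∧
      ∀ γ : ℝ, P.IsGamma α ε γ → ∀ A : CFL.Alg d, P.Solves T₀ A →
        -- a `(1 + ε)`-consistent algorithm is at least `γ`-robust
        (P.Consistent T₀ A (1 + ε) → ∀ r : ℝ, P.Robust T₀ A r → γ ≤ r) ∧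
        -- a strictly better consistency costs a strictly worse robustness
        (∀ b : ℝ, b < 1 + ε → P.Consistent T₀ A b → ∀ r : ℝ, P.Robust T₀ A r → γ < r) := by
  refine ⟨P.existsUnique_isAlpha, fun α hα ε hε hεα => ⟨hα.existsUnique_isGamma hε hεα,
    fun γ hγ A hA => ⟨fun hC r hR => CFL.le_of_consistent_of_robust hα hε hγ hA le_rfl hC hR,
      fun b hb hC r hR => ?_⟩⟩⟩
  have h1 := CFL.le_of_consistent_of_robust hα hε hγ hA hb.le hC hR
  refine lt_of_le_of_ne h1 fun h2 => ?_
  have hγ' := CFL.IsAlpha.isGamma_iff.1 hγ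
  -- If `r = γ`, the trade-off at `γ` gives `ε ≤ b - 1`, contrary to `b < 1 + ε`.
  have h3 : P.surplus γ ≤ b - 1 := CFL.tradeoff hA hC hR h2.ge (hα.1.trans_le hγ'.1.1)
    (hα.denom_pos_of_le hγ'.1.1) hγ'.1.2
  rw [hγ'.2] at h3
  linarith
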